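/- Let $K\ge 0$, $p_1,\dots,p_K\ge 0$ and $p=\prod_k p_k$. For matrices $A_k\in\mathbb R^{p_k\times p_k}$ and an array $\mathcal Y\in\mathbb R^{p_1\times\cdots\times p_K}$ let $((A_1,\dots,A_K)\cdot\mathcal Y)_{[\mathbf i]}=\sum_{\mathbf j}\big(\prod_k (A_k)_{[i_k,j_k]}\big)\mathcal Y_{[\mathbf j]}$, and let $\mathcal Y_{(k)}$ be the mode-$k$ unfolding of $\mathcal Y$. For every array $\mathcal Y$ fix a higher-order singular value decomposition: orthogonal matrices $U_k=U_k(\mathcal Y)$ and numbers $\sigma_1^k\ge\cdots\ge\sigma_{p_k}^k\ge 0$ ($\sigma_i^k=\sigma_i^k(\mathcal Y)$) with $\mathcal Y_{(k)}\mathcal Y_{(k)}^T=U_kD_k^2U_k^T$, $D_k=\mathrm{diag}(\sigma_1^k,\dots,\sigma_{p_k}^k)$, that is, left singular vectors and singular values of $\mathcal Y_{(k)}$, $k=1,\dots,K$. The choice is arbitrary. Put $U=(U_1,\dots,U_K)$, $U^T=(U_1^T,\dots,U_K^T)$, $D=(D_1,\dots,D_K)$, $D^{-1}=(D_1^{-1},\dots,D_K^{-1})$,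 $\mathcal S=U^T\cdot\mathcal Y$ (so $\mathcal Y=U\cdot\mathcal S$) and $\mathcal V=D^{-1}\cdot\mathcal S$. Given functions $f_i^k:\mathbb R\to\mathbb R$ ($1\le k\le K$, $1\le i\le p_k$), put $f^k(D_k)=\mathrm{diag}(f_1^k(\sigma_1^k),\dots,f_{p_k}^k(\sigma_{p_k}^k))$ and $f(D)=(f^1(D_1),\dots,f^K(D_K))$. The higher-order spectral estimator is $t(\mathcal Y)=U\cdot f(D)\cdot\mathcal V$. (If some $D_k$ is singular, any convention may be used for $D_k^{-1}$; this does not affect the result.) Let $\mathcal X$ be an array such that, for each $k$, the mode-$k$ singular values $\sigma_1^k,\dots,\sigma_{p_k}^k$ of $\mathcal X$ are positive and pairwise distinct, and such that each $f_i^k$ is differentiable at $\sigma_i^k=\sigma_i^k(\mathcal X)$. Below, $U,D,\mathcal S$ are evaluated at $\mathcal X$. Then $t$ is differentiable at $\mathcal X$, and its divergence $\mathrm{div}\,t(\mathcal X)=\sum_{\mathbf i}\partial t_{[\mathbf i]}/\partial\mathcal X_{[\mathbf i]}$ is $$\mathrm{div}\,t(\mathcal X)=\mathrm{sum}\Big(f(D)\cdot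 D^{-1}\cdot\mathcal C+\sum_{k=1}^K H_k\cdot\mathcal S^2\Big),$$ where $\mathrm{sum}$ adds all entries of an array, $\mathcal S^2$ is the elementwise square, $$H_k=\big(f^1(D_1)D_1^{-1},\dots,f^{k-1}(D_{k-1})D_{k-1}^{-1},\ \mathrm{diag}\big((f_1^k)'(\sigma_1^k),\dots,(f_{p_k}^k)'(\sigma_{p_k}^k)\big)D_k^{-2},\ f^{k+1}(D_{k+1})D_{k+1}^{-1},\dots,f^K(D_K)D_K^{-1}\big),$$ $$\mathcal C_{[\mathbf i]}=1+\sum_{k=1}^K\sum_{j\ne i_k}\frac{\mathcal S_{[i_1,\dots,i_{k-1},j,i_{k+1},\dots,i_K]}^2}{(\sigma_{i_k}^k)^2-(\sigma_j^k)^2}-\mathcal S_{[\mathbf i]}^2\sum_{k=1}^K\Big(\frac1{(\sigma_{i_k}^k)^2}+\sum_{m\ne i_k}\frac1{(\sigma_m^k)^2-(\sigma_{i_k}^k)^2}\Big).$$ Consequently, for every $\tau\in\mathbb R$, Stein's unbiased risk estimate $\mathrm{SURE}(t(\mathcal X))=-p\tau^2+\|t(\mathcal X)-\mathcal X\|^2+2\tau^2\,\mathrm{div}\,t(\mathcal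 X)$ (with $\|\cdot\|$ the Frobenius norm) has the closed form $$\mathrm{SURE}(t(\mathcal X))=\|f(D)\cdot D^{-1}\cdot\mathcal S-\mathcal S\|^2+2\tau^2\,\mathrm{sum}\Big(f(D)\cdot D^{-1}\cdot\mathcal C+\sum_{k=1}^K H_k\cdot\mathcal S^2\Big)-p\tau^2 .$$ -/

import Mathlib

open scoped Matrix

noncomputable section

/-- Real arrays (tensors) of dimension `p 0 × ⋯ × p (K - 1)`. -/
abbrev Tensor {K : ℕ} (p : Fin K → ℕ) : Type :=
  (∀ k, Fin (p k)) → ℝ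

/-- Lists of square matrices, one of size `p k × p k` for each mode `k`. -/
abbrev ModeMatrices {K : ℕ} (p : Fin K → ℕ) : Type :=
  ∀ k, Matrix (Fin (p k)) (Fin (p k)) ℝ

namespace Tensor

variable {K : ℕ} {p : Fin K → ℕ}

/-- The multilinear (Tucker) product `(A_1, …, A_K) · X`. -/
def tucker (A : ModeMatrices p) (X : Tensor p) : Tensor p :=
  fun i => ∑ j : (∀ k, Fin (p k)), (∏ k, A k (i k) (j k)) * X j

/-- The mode-`k` unfolding (matricization) `X_(k)`: the rows are indexed by the `k`-th index, the
columns by all the other indices. -/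
def unfolding (X : Tensor p) (k : Fin K) :
    Matrix (Fin (p k)) (∀ l : {l : Fin K // l ≠ k}, Fin (p l)) ℝ :=
  Matrix.of fun a c => X ((Equiv.piSplitAt k fun l => Fin (p l)).symm (a, c))

/-- `U` and `σ` are a higher-order singular value decomposition of `X`: for each mode `k`, `U k` is
orthogonal, its columns are left singular vectors of `X_(k)`, and `σ k` lists the corresponding
mode-`k` singular values in decreasing order. The core array is `tucker (fun k => (U k)ᵀ) X`. -/
structure IsHOSVD (X : Tensor p) (U : ModeMatrices p) (σ : ∀ k, Fin (p k) → ℝ) : Prop where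
  orthogonal : ∀ k, U k ∈ Matrix.orthogonalGroup (Fin (p k)) ℝ
  nonneg : ∀ k i, 0 ≤ σ k i
  antitone : ∀ k, Antitone (σ k)
  gram : ∀ k, X.unfolding k * (X.unfolding k)ᵀ =
    U k * (Matrix.diagonal (σ k) * Matrix.diagonal (σ k)) * (U k)ᵀ

/-- The core array `S = Uᵀ · X`. -/
def core (U : ModeMatrices p) (X : Tensor p) : Tensor p :=
  tucker (fun k => (U k)ᵀ) X

/-- The list `D = (D_1, …, D_K)` of diagonal matrices of mode-specific singular values. -/
def diagD (σ : ∀ k, Fin (p k) → ℝ) : ModeMatrices p :=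
  fun k => Matrix.diagonal (σ k)

/-- The list `D⁻¹ = (D_1⁻¹, …, D_K⁻¹)`. -/
def diagDInv (σ : ∀ k, Fin (p k) → ℝ) : ModeMatrices p :=
  fun k => (diagD σ k)⁻¹

/-- The list `f(D) = (f^1(D_1), …, f^K(D_K))`, where
`f^k(D_k) = diag(f^k_1(σ^k_1), …, f^k_{p_k}(σ^k_{p_k}))`. -/
def diagF (f : ∀ k, Fin (p k) → ℝ → ℝ) (σ : ∀ k, Fin (p k) → ℝ) : ModeMatrices p :=
  fun k => Matrix.diagonal fun i => f k i (σ k i)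

/-- The higher-order spectral estimator `t(X) = U · f(D) · V` with `V = D⁻¹ · S`, for a given choice
`Y ↦ (U Y, σ Y)` of HOSVDs. -/
def spectralEstimator (f : ∀ k, Fin (p k) → ℝ → ℝ) (U : Tensor p → ModeMatrices p)
    (σ : Tensor p → ∀ k, Fin (p k) → ℝ) (X : Tensor p) : Tensor p :=
  tucker (U X) (tucker (diagF f (σ X)) (tucker (diagDInv (σ X)) (core (U X) X)))

/-- The divergence `∑_i ∂t_i/∂x_i` of a map of arrays, at a point of differentiability. -/
def divergence (t : Tensor p → Tensor p) (X : Tensor p) : ℝ :=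
  ∑ i, fderiv ℝ t X (Pi.single i 1) i

/-- Squared Euclidean (Frobenius) norm of an array. -/
def frobSq (X : Tensor p) : ℝ := ∑ i, X i ^ 2

/-- Stein's unbiased risk estimate of the estimator `t` at the data `X`, for noise variance
`τ ^ 2`. -/
def sure (τ : ℝ) (t : Tensor p → Tensor p) (X : Tensor p) : ℝ :=
  -((∏ k, p k : ℕ) : ℝ) * τ ^ 2 + frobSq (t X - X) + 2 * τ ^ 2 * divergence t X

/-- The array `C`, in terms of the core array `S` and the mode-specific singular values. -/
def arrayC (S : Tensor p) (σ : ∀ k, Fin (p k) → ℝ) : Tensor p := fun i =>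
  1 + (∑ k, ∑ j ∈ Finset.univ.erase (i k),
        S (Function.update i k j) ^ 2 / (σ k (i k) ^ 2 - σ k j ^ 2))
    - S i ^ 2 * ∑ k, (1 / σ k (i k) ^ 2
        + ∑ m ∈ Finset.univ.erase (i k), 1 / (σ k m ^ 2 - σ k (i k) ^ 2))

/-- The list `H_k`, whose `l`-th entry is `f^l(D_l) D_l⁻¹` for `l ≠ k`, and whose `k`-th entry is
`diag((f^k_1)'(σ^k_1), …, (f^k_{p_k})'(σ^k_{p_k})) D_k⁻²`. -/
def listH (f : ∀ k, Fin (p k) → ℝ → ℝ) (σ : ∀ k, Fin (p k) → ℝ) (k : Fin K) :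
    ModeMatrices p := fun l =>
  if l = k then
    Matrix.diagonal (fun i => deriv (f l i) (σ l i)) * (diagDInv σ l * diagDInv σ l)
  else diagF f σ l * diagDInv σ l

/-- The closed form `sum(f(D) · D⁻¹ · C + ∑_k H_k · S²)`, with `S²` the elementwise square. -/
def divergenceFormula (f : ∀ k, Fin (p k) → ℝ → ℝ) (S : Tensor p)
    (σ : ∀ k, Fin (p k) → ℝ) : ℝ :=
  ∑ i, (tucker (diagF f σ) (tucker (diagDInv σ) (arrayC S σ))
    + ∑ k, tucker (listH f σ k) (S ^ 2)) i

/-- Every array has a higher-order singular value decomposition. -/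
theorem exists_isHOSVD (X : Tensor p) : ∃ U σ, IsHOSVD X U σ := by
  have key : ∀ k, ∃ (V : Matrix (Fin (p k)) (Fin (p k)) ℝ) (s : Fin (p k) → ℝ),
      V ∈ Matrix.orthogonalGroup (Fin (p k)) ℝ ∧ (∀ i, 0 ≤ s i) ∧ Antitone s ∧
      X.unfolding k * (X.unfolding k)ᵀ =
        V * (Matrix.diagonal s * Matrix.diagonal s) * Vᵀ := by
    intro k
    have hps : (X.unfolding k * (X.unfolding k)ᵀ).PosSemidef := by
      simpa using Matrix.posSemidef_self_mul_conjTranspose (X.unfolding k)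
    have hA := hps.isHermitian
    let e : Equiv.Perm (Fin (p k)) := Tuple.sort (fun i => - hA.eigenvalues i)
    have he : Monotone ((fun i => - hA.eigenvalues i) ∘ e) := Tuple.monotone_sort _
    have hV := hA.eigenvectorUnitary.2
    refine ⟨(hA.eigenvectorUnitary : Matrix _ _ ℝ).submatrix id e,
      fun i => √(hA.eigenvalues (e i)), ?_, fun i => Real.sqrt_nonneg _, ?_, ?_⟩
    · rw [Matrix.mem_orthogonalGroup_iff]
      rw [Matrix.mem_unitaryGroup_iff] at hV
      rw [Matrix.transpose_submatrix, Matrix.submatrix_mul_equiv]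
      simpa [Matrix.star_eq_conjTranspose] using hV
    · intro i j hij
      have := he hij
      simp only [Function.comp] at this
      exact Real.sqrt_le_sqrt (by linarith)
    · have h1 : (Matrix.diagonal fun i => √(hA.eigenvalues (e i))) *
          (Matrix.diagonal fun i => √(hA.eigenvalues (e i))) =
          (Matrix.diagonal hA.eigenvalues).submatrix e e := by
        rw [Matrix.diagonal_mul_diagonal, Matrix.submatrix_diagonal_equiv]
        congr 1
        funext i
        exact Real.mul_self_sqrt (hps.eigenvalues_nonneg _)
      rw [h1, Matrix.transpose_submatrix, Matrix.submatrix_mul_equiv, Matrix.submatrix_mul_equiv]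
      have h2 := hA.spectral_theorem
      simpa [Unitary.conjStarAlgAut_apply, Matrix.star_eq_conjTranspose, Function.comp_def] using h2
  choose V s h using key
  exact ⟨V, s, fun k => (h k).1, fun k => (h k).2.1, fun k => (h k).2.2.1, fun k => (h k).2.2.2⟩

end Tensor

end

/-!
Where all singular values of `Y` are positive, the estimator is `t(Y) = (B_1(Y), …, B_K(Y)) · Y` with
`B_k(Y) = U_k diag(f^k_i(σ^k_i) / σ^k_i) U_kᵀ`. This is a function of the Gram matrix
`G_k = Y_(k) Y_(k)ᵀ`, with eigenvalues `(σ^k_i)²`, so it does not depend on the signs of the singular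
vectors; near an array with distinct singular values no other choice is left. Everything reduces to
differentiating the `B_k`.

*Reduction to the core array.* The map `t` is equivariant under orthogonal changes of coordinates
in each mode (`spectralEstimator_rotate`) and the divergence is the trace of the derivative, hence
invariant (`divergence_conj`). Rotating by the singular vectors of `X` replaces `X` by its core
array `S`, whose Gram matrices are diagonal.

*Perturbation theory.* Let `M diag(μ) Mᵀ = diag(λ) + E` with `M` orthogonal, `λ` strictly decreasing,
`μ` decreasing and `E` tending to zero. Each `λ_a` has some `μ_i` within the size of `E`; small
perturbations make this matching strictly monotone, hence the identity (`abs_sub_le`). It follows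
that the off-diagonal entries of `M` are `O(E)`, so the diagonal of `M diag(c) Mᵀ` is `c` up to
`O(E²)`. For `B = M diag(g(μ)) Mᵀ` this gives convergence to `diag(g(λ))` and the diagonal of the
first-order term. The off-diagonal part comes from the commutation of `B` with `diag(λ) + E`, which
reads `B_ab (λ_a - λ_b) = (B E - E B)_ab`. Altogether
(`DiagonalPerturbation.IsPerturbation.isLittleO_conj`) the first-order term of `B` has entries
`(g_a(λ_a) - g_b(λ_b)) / (λ_a - λ_b) E_ab` for `a ≠ b` and `g_a'(λ_a) E_aa`. No choice of continuous
or differentiable eigenvectors is needed.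

*Divergence.* The product rule at `S` gives `hasFDerivAt_spectralEstimator`. In the diagonal of this
derivative only entries of `S` on the mode-`k` fibers through `i` survive
(`divergence_spectralEstimator`). Exchanging `i_k` with the running index in the terms containing
`f_b` (`sum_prod_erase_swap`) turns the result into the closed formula.
-/

namespace Tensor

variable {K : ℕ} {p : Fin K → ℕ}

/-! ### Algebra of the multilinear product -/

theorem tucker_tucker (A B : ModeMatrices p) (X : Tensor p) :
    tucker A (tucker B X) = tucker (fun k => A k * B k) X := by
  funext i
  simp only [tucker, Finset.mul_sum]
  rw [Finset.sum_comm]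
  refine Finset.sum_congr rfl fun j _ => ?_
  simp only [Matrix.mul_apply, Finset.prod_univ_sum, Fintype.piFinset_univ, Finset.sum_mul,
    Finset.prod_mul_distrib, mul_assoc]

theorem tucker_diagonal (d : ∀ k, Fin (p k) → ℝ) (X : Tensor p) (i : ∀ k, Fin (p k)) :
    tucker (fun k => Matrix.diagonal (d k)) X i = (∏ k, d k (i k)) * X i := by
  rw [tucker, Finset.sum_eq_single i]
  · simp
  · intro j _ hj
    obtain ⟨k, hk⟩ := Function.ne_iff.1 hj
    rw [Finset.prod_eq_zero (Finset.mem_univ k), zero_mul]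
    exact Matrix.diagonal_apply_ne _ hk.symm
  · simp

theorem tucker_one (X : Tensor p) : tucker (fun _ => 1) X = X := by
  funext i
  have := tucker_diagonal (p := p) (fun _ _ => 1) X i
  simpa using this

/-- The multilinear product by a fixed list of matrices, as a linear map of arrays. -/
def tuckerLin (A : ModeMatrices p) : Tensor p →ₗ[ℝ] Tensor p where
  toFun := tucker A
  map_add' X Y := by
    funext i
    simp [tucker, mul_add, Finset.sum_add_distrib]
  map_smul' c X := by
    funext i
    simp only [tucker, Pi.smul_apply, smul_eq_mul, Finset.mul_sum, RingHom.id_apply]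
    exact Finset.sum_congr rfl fun j _ => by ring

theorem tucker_sub (A : ModeMatrices p) (X Y : Tensor p) :
    tucker A (X - Y) = tucker A X - tucker A Y := (tuckerLin A).map_sub X Y

theorem orthogonal_transpose_mul {n : ℕ} {Q : Matrix (Fin n) (Fin n) ℝ}
    (hQ : Q ∈ Matrix.orthogonalGroup (Fin n) ℝ) : Qᵀ * Q = 1 :=
  (Matrix.mem_orthogonalGroup_iff' _ _).1 hQ

theorem orthogonal_mul_transpose {n : ℕ} {Q : Matrix (Fin n) (Fin n) ℝ}
    (hQ : Q ∈ Matrix.orthogonalGroup (Fin n) ℝ) : Q * Qᵀ = 1 :=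
  (Matrix.mem_orthogonalGroup_iff _ _).1 hQ

theorem tucker_transpose_tucker {Q : ModeMatrices p}
    (hQ : ∀ k, Q k ∈ Matrix.orthogonalGroup (Fin (p k)) ℝ) (X : Tensor p) :
    tucker (fun k => (Q k)ᵀ) (tucker Q X) = X := by
  rw [tucker_tucker]
  simp only [orthogonal_transpose_mul (hQ _), tucker_one]

theorem tucker_tucker_transpose {Q : ModeMatrices p}
    (hQ : ∀ k, Q k ∈ Matrix.orthogonalGroup (Fin (p k)) ℝ) (X : Tensor p) :
    tucker Q (tucker (fun k => (Q k)ᵀ) X) = X := by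
  rw [tucker_tucker]
  simp only [orthogonal_mul_transpose (hQ _), tucker_one]

/-- The multilinear product by orthogonal matrices, as a linear automorphism. -/
def tuckerEquiv (Q : ModeMatrices p) (hQ : ∀ k, Q k ∈ Matrix.orthogonalGroup (Fin (p k)) ℝ) :
    Tensor p ≃ₗ[ℝ] Tensor p :=
  LinearEquiv.ofLinearMap (tuckerLin Q) (tuckerLin fun k => (Q k)ᵀ)
    (LinearMap.ext (tucker_tucker_transpose hQ)) (LinearMap.ext (tucker_transpose_tucker hQ))

theorem sum_tucker_mul (A : ModeMatrices p) (X Y : Tensor p) :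
    ∑ i, tucker A X i * Y i = ∑ i, X i * tucker (fun k => (A k)ᵀ) Y i := by
  simp only [tucker, Finset.sum_mul, Finset.mul_sum, Matrix.transpose_apply]
  rw [Finset.sum_comm]
  exact Finset.sum_congr rfl fun i _ => Finset.sum_congr rfl fun j _ => by ring

theorem frobSq_tucker {Q : ModeMatrices p}
    (hQ : ∀ k, Q k ∈ Matrix.orthogonalGroup (Fin (p k)) ℝ) (X : Tensor p) :
    frobSq (tucker Q X) = frobSq X := by
  simp only [frobSq, sq]
  rw [sum_tucker_mul, tucker_transpose_tucker hQ]

/-- Unfolding turns the multilinear product into a product of matrices; the right factor is the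
Kronecker product of the matrices of the other modes. -/
theorem unfolding_tucker (A : ModeMatrices p) (X : Tensor p) (k : Fin K) :
    (tucker A X).unfolding k = A k * X.unfolding k *
      (Matrix.of fun c d : ∀ l : {l : Fin K // l ≠ k}, Fin (p l) =>
        ∏ l : {l : Fin K // l ≠ k}, A l (c l) (d l))ᵀ := by
  ext a c
  simp only [unfolding, Matrix.of_apply, tucker, Matrix.mul_apply, Matrix.transpose_apply]
  rw [← (Equiv.piSplitAt k fun l => Fin (p l)).symm.sum_comp, Fintype.sum_prod_type_right]
  refine Finset.sum_congr rfl fun d _ => ?_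
  rw [Finset.sum_mul]
  refine Finset.sum_congr rfl fun b _ => ?_
  rw [Fintype.prod_eq_mul_prod_subtype_ne _ k]
  have h : ∀ l : {l : Fin K // l ≠ k}, A l
      ((Equiv.piSplitAt k fun l => Fin (p l)).symm (a, c) l)
      ((Equiv.piSplitAt k fun l => Fin (p l)).symm (b, d) l) = A l (c l) (d l) := by
    rintro ⟨l, hl⟩
    simp [Equiv.piSplitAt, hl]
  simp only [h]
  simp [Equiv.piSplitAt]
  ring

theorem gram_unfolding_tucker {Q : ModeMatrices p}
    (hQ : ∀ k, Q k ∈ Matrix.orthogonalGroup (Fin (p k)) ℝ) (X : Tensor p) (k : Fin K) :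
    (tucker Q X).unfolding k * ((tucker Q X).unfolding k)ᵀ =
      Q k * (X.unfolding k * (X.unfolding k)ᵀ) * (Q k)ᵀ := by
  rw [unfolding_tucker]
  set W : Matrix (∀ l : {l : Fin K // l ≠ k}, Fin (p l))
      (∀ l : {l : Fin K // l ≠ k}, Fin (p l)) ℝ :=
    Matrix.of fun c d => ∏ l : {l : Fin K // l ≠ k}, Q l (c l) (d l) with hW
  have h : Wᵀ * W = 1 := by
    ext c d
    have h1 : ∀ l : {l : Fin K // l ≠ k}, ∑ m, Q l m (c l) * Q l m (d l) =
        if c l = d l then 1 else 0 := by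
      intro l
      have := congr_fun₂ (orthogonal_transpose_mul (hQ l)) (c l) (d l)
      simpa [Matrix.mul_apply, Matrix.one_apply] using this
    simp only [hW, Matrix.mul_apply, Matrix.transpose_apply, Matrix.of_apply,
      ← Finset.prod_mul_distrib]
    have h2 := Finset.prod_univ_sum (fun l : {l : Fin K // l ≠ k} => Finset.univ)
      (fun l m => Q l m (c l) * Q l m (d l))
    rw [Fintype.piFinset_univ] at h2
    rw [← h2]
    simp only [h1, Matrix.one_apply, Finset.prod_ite_zero, Finset.prod_const_one]
    simp [funext_iff]
  simp only [Matrix.transpose_mul, Matrix.transpose_transpose, Matrix.mul_assoc]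
  rw [← Matrix.mul_assoc Wᵀ, h, Matrix.one_mul]

end Tensor

/-! ### First-order perturbation of diagonal matrices with simple spectrum -/

namespace DiagonalPerturbation

open Filter Asymptotics Topology

variable {n : ℕ}

/-- The sum of the absolute values of the entries of a matrix. -/
def entrySum (E : Matrix (Fin n) (Fin n) ℝ) : ℝ := ∑ a, ∑ b, |E a b|

theorem entrySum_nonneg (E : Matrix (Fin n) (Fin n) ℝ) : 0 ≤ entrySum E :=
  Finset.sum_nonneg fun _ _ => Finset.sum_nonneg fun _ _ => abs_nonneg _

theorem sum_abs_le_entrySum (E : Matrix (Fin n) (Fin n) ℝ) (a : Fin n) :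
    ∑ b, |E a b| ≤ entrySum E :=
  Finset.single_le_sum (f := fun a => ∑ b, |E a b|)
    (fun _ _ => Finset.sum_nonneg fun _ _ => abs_nonneg _) (Finset.mem_univ a)

theorem abs_le_entrySum (E : Matrix (Fin n) (Fin n) ℝ) (a b : Fin n) :
    |E a b| ≤ entrySum E :=
  (Finset.single_le_sum (f := fun b => |E a b|) (fun _ _ => abs_nonneg _)
    (Finset.mem_univ b)).trans (sum_abs_le_entrySum E a)

section Deterministic

variable {M E : Matrix (Fin n) (Fin n) ℝ} {lam mu : Fin n → ℝ}

theorem sum_row_sq (hM : M * Mᵀ = 1) (a : Fin n) : ∑ i, M a i ^ 2 = 1 := by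
  have := congr_fun₂ hM a a
  simpa [Matrix.mul_apply, sq] using this

theorem abs_entry_le_one (hM : M * Mᵀ = 1) (a i : Fin n) : |M a i| ≤ 1 := by
  rw [← sq_le_one_iff_abs_le_one, ← sum_row_sq hM a]
  exact Finset.single_le_sum (f := fun i => M a i ^ 2) (fun _ _ => sq_nonneg _) (Finset.mem_univ i)

/-- The eigenvector equation, in coordinates. -/
theorem entry_mul_sub (hM : M * Mᵀ = 1)
    (h : M * Matrix.diagonal mu * Mᵀ = Matrix.diagonal lam + E) (a i : Fin n) :
    M a i * (mu i - lam a) = (E * M) a i := by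
  have h1 : M * Matrix.diagonal mu = Matrix.diagonal lam * M + E * M := by
    rw [← Matrix.add_mul, ← h, Matrix.mul_assoc, mul_eq_one_comm.1 hM, Matrix.mul_one]
  have h2 := congr_fun₂ h1 a i
  rw [Matrix.add_apply, Matrix.mul_diagonal, Matrix.diagonal_mul] at h2
  linarith

theorem abs_mul_entry_le (hM : M * Mᵀ = 1) (a i : Fin n) : |(E * M) a i| ≤ entrySum E := by
  rw [Matrix.mul_apply]
  refine (Finset.abs_sum_le_sum_abs _ _).trans
    ((Finset.sum_le_sum fun b _ => ?_).trans (sum_abs_le_entrySum E a))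
  rw [abs_mul]
  exact mul_le_of_le_one_right (abs_nonneg _) (abs_entry_le_one hM b i)

/-- Every eigenvalue of the diagonal matrix is close to an eigenvalue of the perturbed one. -/
theorem exists_abs_sub_le (hM : M * Mᵀ = 1)
    (h : M * Matrix.diagonal mu * Mᵀ = Matrix.diagonal lam + E) (a : Fin n) :
    ∃ i, |mu i - lam a| ≤ entrySum E := by
  by_contra! hcon
  -- the average of `(mu i - lam a) ^ 2` with weights `M a i ^ 2` is at most `entrySum E ^ 2`
  have h1 : ∑ i, (M a i * (mu i - lam a)) ^ 2 = ∑ b, E a b ^ 2 := by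
    simp only [entry_mul_sub hM h]
    have h2 : (E * M) * (E * M)ᵀ = E * Eᵀ := by
      rw [Matrix.transpose_mul, Matrix.mul_assoc, ← Matrix.mul_assoc M, hM, Matrix.one_mul]
    have h3 := congr_fun₂ h2 a a
    rw [Matrix.mul_apply, Matrix.mul_apply] at h3
    simpa [sq] using h3
  have h4 : ∑ b, E a b ^ 2 ≤ entrySum E ^ 2 := by
    calc ∑ b, E a b ^ 2 = ∑ b, |E a b| ^ 2 := by simp
      _ ≤ (∑ b, |E a b|) ^ 2 := Finset.sum_sq_le_sq_sum_of_nonneg fun _ _ => abs_nonneg _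
      _ ≤ entrySum E ^ 2 := pow_le_pow_left₀
          (Finset.sum_nonneg fun _ _ => abs_nonneg _) (sum_abs_le_entrySum E a) 2
  have h5 : ∀ i, entrySum E ^ 2 < (mu i - lam a) ^ 2 := fun i =>
    sq_lt_sq.2 (by rw [abs_of_nonneg (entrySum_nonneg E)]; exact hcon i)
  have h6 : ∑ i, M a i ^ 2 * entrySum E ^ 2 < ∑ i, (M a i * (mu i - lam a)) ^ 2 := by
    refine Finset.sum_lt_sum (fun i _ => ?_) ?_
    · rw [mul_pow]
      exact mul_le_mul_of_nonneg_left (h5 i).le (sq_nonneg _)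
    · obtain ⟨i, hi, hne⟩ := Finset.exists_ne_zero_of_sum_ne_zero
        (by rw [sum_row_sq hM a]; exact one_ne_zero)
      exact ⟨i, hi, by
        rw [mul_pow]; exact mul_lt_mul_of_pos_left (h5 i) ((sq_nonneg _).lt_of_ne' hne)⟩
  rw [← Finset.sum_mul, sum_row_sq hM, one_mul] at h6
  linarith

/-- If the perturbation is small compared with the spectral gaps, eigenvalues listed in decreasing
order are matched index by index. -/
theorem abs_sub_le (hM : M * Mᵀ = 1) (hmu : Antitone mu) (hlam : StrictAnti lam)
    (h : M * Matrix.diagonal mu * Mᵀ = Matrix.diagonal lam + E)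
    (hgap : ∀ a b, a ≠ b → 2 * entrySum E < |lam a - lam b|) (i : Fin n) :
    |mu i - lam i| ≤ entrySum E := by
  choose π hπ using exists_abs_sub_le hM h
  have hmono : StrictMono π := by
    intro a b hab
    by_contra! hle
    have h1 := hgap a b hab.ne
    rw [abs_of_pos (sub_pos.2 (hlam hab))] at h1
    have h2 := abs_le.1 (hπ a)
    have h3 := abs_le.1 (hπ b)
    have h4 := hmu hle
    linarith [h2.1, h3.2]
  -- a strictly monotone self-map of a finite linear order is the identity
  have hid : π = id := hmono.range_inj strictMono_id |>.1 <| by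
    rw [(Finite.surjective_of_injective hmono.injective).range_eq, Set.range_id]
  simpa [hid] using hπ i

/-- Off the diagonal, the rotation onto the perturbed eigenvectors is of first order in the
perturbation. -/
theorem abs_entry_le (hM : M * Mᵀ = 1) (hmu : Antitone mu) (hlam : StrictAnti lam)
    (h : M * Matrix.diagonal mu * Mᵀ = Matrix.diagonal lam + E)
    (hgap : ∀ a b, a ≠ b → 2 * entrySum E < |lam a - lam b|) {a i : Fin n} (hai : a ≠ i) :
    |M a i| ≤ 2 / |lam a - lam i| * entrySum E := by
  have h1 := abs_sub_le hM hmu hlam h hgap i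
  have h2 := abs_mul_entry_le (E := E) hM a i
  rw [← entry_mul_sub hM h, abs_mul] at h2
  have h3 := hgap a i hai
  have h4 : |lam a - lam i| / 2 ≤ |mu i - lam a| := by
    have := abs_sub_abs_le_abs_sub (lam a - lam i) (mu i - lam i)
    rw [show lam a - lam i - (mu i - lam i) = -(mu i - lam a) by ring, abs_neg] at this
    linarith
  have h5 : 0 < |lam a - lam i| := abs_pos.2 (sub_ne_zero.2 (hlam.injective.ne hai))
  rw [div_mul_eq_mul_div, le_div_iff₀ h5]
  nlinarith [mul_le_mul_of_nonneg_left h4 (abs_nonneg (M a i))]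

end Deterministic

section Asymptotic

variable {α : Type*} {l : Filter α} {M E : α → Matrix (Fin n) (Fin n) ℝ} {lam : Fin n → ℝ}
  {mu : α → Fin n → ℝ}

/-- The coefficients of the first-order change of `M diag(g(mu)) Mᵀ`: divided differences of the
values `c₀ = g(lam)` off the diagonal, derivatives `c' = g'(lam)` on it. -/
noncomputable def coeff (lam c₀ c' : Fin n → ℝ) (a b : Fin n) : ℝ :=
  if a = b then c' a else (c₀ a - c₀ b) / (lam a - lam b)

/-- An orthogonal eigendecomposition, with eigenvalues in decreasing order, of a perturbation `E`,
tending to zero along `l`, of a diagonal matrix with strictly decreasing entries. -/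
structure IsPerturbation (l : Filter α) (M E : α → Matrix (Fin n) (Fin n) ℝ) (lam : Fin n → ℝ)
    (mu : α → Fin n → ℝ) : Prop where
  orthogonal : ∀ y, M y * (M y)ᵀ = 1
  antitone : ∀ y, Antitone (mu y)
  strictAnti : StrictAnti lam
  eq : ∀ y, M y * Matrix.diagonal (mu y) * (M y)ᵀ = Matrix.diagonal lam + E y
  tendsto : Tendsto (fun y => entrySum (E y)) l (𝓝 0)

namespace IsPerturbation

theorem eventually_gap (h : IsPerturbation l M E lam mu) :
    ∀ᶠ y in l, ∀ a b, a ≠ b → 2 * entrySum (E y) < |lam a - lam b| := by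
  simp only [eventually_all]
  intro a b hab
  have h1 : 0 < |lam a - lam b| := abs_pos.2 (sub_ne_zero.2 (h.strictAnti.injective.ne hab))
  have h2 := h.tendsto.const_mul 2
  rw [mul_zero] at h2
  exact h2.eventually_lt_const h1

theorem isBigO_eigenvalue (h : IsPerturbation l M E lam mu) (i : Fin n) :
    (fun y => mu y i - lam i) =O[l] fun y => entrySum (E y) := by
  refine IsBigO.of_bound 1 ?_
  filter_upwards [h.eventually_gap] with y hy
  rw [one_mul, Real.norm_eq_abs, Real.norm_eq_abs, abs_of_nonneg (entrySum_nonneg _)]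
  exact abs_sub_le (h.orthogonal y) (h.antitone y) h.strictAnti (h.eq y) hy i

theorem tendsto_eigenvalue (h : IsPerturbation l M E lam mu) (i : Fin n) :
    Tendsto (fun y => mu y i) l (𝓝 (lam i)) := by
  have := (h.isBigO_eigenvalue i).trans_tendsto h.tendsto
  simpa using this.add_const (lam i)

theorem isBigO_entry (h : IsPerturbation l M E lam mu) {a i : Fin n} (hai : a ≠ i) :
    (fun y => M y a i) =O[l] fun y => entrySum (E y) := by
  refine IsBigO.of_bound (2 / |lam a - lam i|) ?_
  filter_upwards [h.eventually_gap] with y hy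
  rw [Real.norm_eq_abs, Real.norm_eq_abs, abs_of_nonneg (entrySum_nonneg _)]
  exact abs_entry_le (h.orthogonal y) (h.antitone y) h.strictAnti (h.eq y) hy hai

theorem isBigO_perturbation (a b : Fin n) :
    (fun y => E y a b) =O[l] fun y => entrySum (E y) := by
  refine IsBigO.of_bound 1 (Eventually.of_forall fun y => ?_)
  rw [one_mul, Real.norm_eq_abs, Real.norm_eq_abs, abs_of_nonneg (entrySum_nonneg _)]
  exact abs_le_entrySum _ _ _

theorem isBigO_entry_one (h : IsPerturbation l M E lam mu) (a i : Fin n) :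
    (fun y => M y a i) =O[l] fun _ => (1 : ℝ) :=
  IsBigO.of_bound 1 (Eventually.of_forall fun y => by
    simpa using abs_entry_le_one (h.orthogonal y) a i)

/-- The diagonal of `M diag(c) Mᵀ` agrees with `c` to first order: the squares of the off-diagonal
entries of `M` are of second order. -/
theorem isLittleO_diag (h : IsPerturbation l M E lam mu) {c : α → Fin n → ℝ}
    (hc : ∀ i, (fun y => c y i) =O[l] fun _ => (1 : ℝ)) (a : Fin n) :
    (fun y => (M y * Matrix.diagonal (c y) * (M y)ᵀ) a a - c y a) =o[l]
      fun y => entrySum (E y) := by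
  have h1 : ∀ y, (M y * Matrix.diagonal (c y) * (M y)ᵀ) a a - c y a =
      ∑ i, M y a i * (M y a i * (c y i - c y a)) := by
    intro y
    have h2 : c y a = ∑ i, M y a i ^ 2 * c y a := by
      rw [← Finset.sum_mul, sum_row_sq (h.orthogonal y), one_mul]
    conv_lhs => rw [h2]
    rw [Matrix.mul_apply, ← Finset.sum_sub_distrib]
    refine Finset.sum_congr rfl fun i _ => ?_
    rw [Matrix.mul_diagonal, Matrix.transpose_apply]
    ring
  simp only [h1]
  refine IsLittleO.fun_sum fun i _ => ?_
  by_cases hai : a = i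
  · subst hai
    simp
  · have h3 : (fun y => M y a i) =o[l] fun _ => (1 : ℝ) :=
      (isLittleO_one_iff ℝ).2 ((h.isBigO_entry hai).trans_tendsto h.tendsto)
    simpa using h3.mul_isBigO ((h.isBigO_entry hai).mul ((hc i).sub (hc a)))

/-- First-order perturbation of the eigenvalues, obtained by taking `c = mu` in
`isLittleO_diag`. -/
theorem isLittleO_eigenvalue (h : IsPerturbation l M E lam mu) (a : Fin n) :
    (fun y => mu y a - lam a - E y a a) =o[l] fun y => entrySum (E y) := by
  have h1 := h.isLittleO_diag (fun i => (h.tendsto_eigenvalue i).isBigO_one ℝ) a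
  refine h1.neg_left.congr_left fun y => ?_
  rw [h.eq y, Matrix.add_apply, Matrix.diagonal_apply_eq]
  ring

/-- If `c` converges, so does `M diag(c) Mᵀ`, to the diagonal matrix of the limits, although the
columns of `M` converge only up to sign. -/
theorem tendsto_conj (h : IsPerturbation l M E lam mu) {c : α → Fin n → ℝ} {c₀ : Fin n → ℝ}
    (hc : ∀ i, Tendsto (fun y => c y i) l (𝓝 (c₀ i))) (a b : Fin n) :
    Tendsto (fun y => (M y * Matrix.diagonal (c y) * (M y)ᵀ) a b) l
      (𝓝 (Matrix.diagonal c₀ a b)) := by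
  by_cases hab : a = b
  · subst hab
    have := ((h.isLittleO_diag (fun i => (hc i).isBigO_one ℝ) a).trans_tendsto h.tendsto).add
      (hc a)
    simpa using this
  · have h1 : ∀ y, (M y * Matrix.diagonal (c y) * (M y)ᵀ) a b =
        ∑ i, M y a i * c y i * M y b i := fun y => by
      rw [Matrix.mul_apply]
      simp only [Matrix.mul_diagonal, Matrix.transpose_apply]
    simp only [h1]
    rw [Matrix.diagonal_apply_ne _ hab, ← Finset.sum_const_zero (s := (Finset.univ : Finset (Fin n)))]
    refine tendsto_finsetSum _ fun i _ => ?_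
    -- at least one of the factors `M y a i` and `M y b i` is off the diagonal
    have h2 : (fun y => M y a i * c y i * M y b i) =O[l] fun y => entrySum (E y) := by
      by_cases hai : a = i
      · have hbi : b ≠ i := fun hb => hab (hai.trans hb.symm)
        simpa using ((h.isBigO_entry_one a i).mul ((hc i).isBigO_one ℝ)).mul (h.isBigO_entry hbi)
      · simpa using ((h.isBigO_entry hai).mul ((hc i).isBigO_one ℝ)).mul (h.isBigO_entry_one b i)
    exact h2.trans_tendsto h.tendsto

/-- Matrices with the same eigenvectors commute; in coordinates this determines the off-diagonal
entries of `M diag(c) Mᵀ` from `E`. -/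
theorem conj_entry_mul_sub (h : IsPerturbation l M E lam mu) (c : α → Fin n → ℝ) (y : α)
    (a b : Fin n) :
    (M y * Matrix.diagonal (c y) * (M y)ᵀ) a b * (lam a - lam b) =
      ∑ i, ((M y * Matrix.diagonal (c y) * (M y)ᵀ) a i * E y i b -
        E y a i * (M y * Matrix.diagonal (c y) * (M y)ᵀ) i b) := by
  set B := M y * Matrix.diagonal (c y) * (M y)ᵀ with hB
  have hM := mul_eq_one_comm.1 (h.orthogonal y)
  have hcomm : B * (Matrix.diagonal lam + E y) = (Matrix.diagonal lam + E y) * B := by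
    have key : ∀ u v : Fin n → ℝ, (M y * Matrix.diagonal u * (M y)ᵀ) *
        (M y * Matrix.diagonal v * (M y)ᵀ) = M y * Matrix.diagonal (fun i => u i * v i) * (M y)ᵀ := by
      intro u v
      rw [← Matrix.diagonal_mul_diagonal]
      simp only [Matrix.mul_assoc]
      rw [← Matrix.mul_assoc (M y)ᵀ (M y), hM, Matrix.one_mul]
    rw [← h.eq y, hB, key, key]
    simp only [mul_comm]
  have h1 := congr_fun₂ hcomm a b
  rw [Matrix.mul_add, Matrix.add_mul, Matrix.add_apply, Matrix.add_apply, Matrix.mul_diagonal,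
    Matrix.diagonal_mul, Matrix.mul_apply, Matrix.mul_apply] at h1
  rw [Finset.sum_sub_distrib]
  linarith

/-- First-order expansion of a function of a perturbed diagonal matrix with simple spectrum. -/
theorem isLittleO_conj (h : IsPerturbation l M E lam mu) {g : Fin n → ℝ → ℝ} {g' : Fin n → ℝ}
    (hg : ∀ i, HasDerivAt (g i) (g' i) (lam i)) (a b : Fin n) :
    (fun y => (M y * Matrix.diagonal (fun i => g i (mu y i)) * (M y)ᵀ) a b -
        Matrix.diagonal (fun i => g i (lam i)) a b -
        coeff lam (fun i => g i (lam i)) g' a b * E y a b) =o[l]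
      fun y => entrySum (E y) := by
  have hc : ∀ i, Tendsto (fun y => g i (mu y i)) l (𝓝 (g i (lam i))) := fun i =>
    (hg i).continuousAt.tendsto.comp (h.tendsto_eigenvalue i)
  by_cases hab : a = b
  · subst hab
    have h1 := h.isLittleO_diag (fun i => (hc i).isBigO_one ℝ) a
    have h2 := ((hg a).isLittleO.comp_tendsto (h.tendsto_eigenvalue a)).trans_isBigO
      (h.isBigO_eigenvalue a)
    have h3 := (h.isLittleO_eigenvalue a).const_mul_left (g' a)
    refine ((h1.add h2).add h3).congr_left fun y => ?_
    simp [coeff]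
    ring
  · have hne : lam a - lam b ≠ 0 := sub_ne_zero.2 (h.strictAnti.injective.ne hab)
    set B := fun y => M y * Matrix.diagonal (fun i => g i (mu y i)) * (M y)ᵀ with hB
    set B₀ := Matrix.diagonal fun i => g i (lam i) with hB₀
    have hBo : ∀ i j, (fun y => B y i j - B₀ i j) =o[l] fun _ => (1 : ℝ) := fun i j =>
      (isLittleO_one_iff ℝ).2 (by
        have := (h.tendsto_conj hc i j).sub_const (B₀ i j)
        rwa [sub_self] at this)
    have h1 : (fun y => (lam a - lam b)⁻¹ * ∑ i, ((B y a i - B₀ a i) * E y i b -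
        E y a i * (B y i b - B₀ i b))) =o[l] fun y => entrySum (E y) := by
      refine IsLittleO.const_mul_left (IsLittleO.fun_sum fun i _ => IsLittleO.sub ?_ ?_) _
      · simpa using (hBo a i).mul_isBigO (isBigO_perturbation (E := E) i b)
      · simpa using (isBigO_perturbation (E := E) a i).mul_isLittleO (hBo i b)
    refine h1.congr_left fun y => ?_
    have h2 := h.conj_entry_mul_sub (fun y i => g i (mu y i)) y a b
    have h3 : ∑ i, ((B y a i - B₀ a i) * E y i b - E y a i * (B y i b - B₀ i b)) =
        B y a b * (lam a - lam b) - (g a (lam a) - g b (lam b)) * E y a b := by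
      have h4 : ∑ i, (B₀ a i * E y i b - E y a i * B₀ i b) =
          (g a (lam a) - g b (lam b)) * E y a b := by
        rw [Finset.sum_sub_distrib, ← Matrix.mul_apply, ← Matrix.mul_apply, hB₀,
          Matrix.diagonal_mul, Matrix.mul_diagonal]
        ring
      have h5 : B y a b * (lam a - lam b) = ∑ i, (B y a i * E y i b - E y a i * B y i b) := h2
      rw [← h4, h5, ← Finset.sum_sub_distrib]
      exact Finset.sum_congr rfl fun i _ => by ring
    rw [h3, hB₀, Matrix.diagonal_apply_ne _ hab, coeff, if_neg hab]
    field_simp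
    ring

end IsPerturbation

end Asymptotic

end DiagonalPerturbation

namespace Tensor

variable {K : ℕ} {p : Fin K → ℕ}

open Filter Asymptotics Topology DiagonalPerturbation

/-! ### Sums over multi-indices -/

theorem piSplitAt_symm_update (k : Fin K) (a b : Fin (p k))
    (c : ∀ l : {l : Fin K // l ≠ k}, Fin (p l)) :
    Function.update ((Equiv.piSplitAt k fun l => Fin (p l)).symm (a, c)) k b =
      (Equiv.piSplitAt k fun l => Fin (p l)).symm (b, c) := by
  funext l
  by_cases hl : l = k
  · subst hl
    simp [Equiv.piSplitAt]
  · simp [Equiv.piSplitAt, hl]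

/-- A product of diagonal matrices over all modes but `k` restricts a sum over multi-indices to
those differing from `i` in mode `k` only. -/
theorem sum_prod_erase_diagonal (d : ∀ k, Fin (p k) → ℝ) (k : Fin K) (i : ∀ k, Fin (p k))
    (F : (∀ k, Fin (p k)) → ℝ) :
    ∑ j, (∏ l ∈ Finset.univ.erase k, Matrix.diagonal (d l) (i l) (j l)) * F j =
      (∏ l ∈ Finset.univ.erase k, d l (i l)) * ∑ b, F (Function.update i k b) := by
  rw [Finset.mul_sum]
  symm
  refine Fintype.sum_of_injective (Function.update i k) (Function.update_injective i k) _ _ ?_ ?_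
  · intro j hj
    have : ∃ l, l ≠ k ∧ j l ≠ i l := by
      by_contra! hcon
      exact hj ⟨j k, funext fun l => by
        by_cases hl : l = k
        · subst hl
          simp
        · simp [hl, hcon l hl]⟩
    obtain ⟨l, hl, hne⟩ := this
    rw [Finset.prod_eq_zero (Finset.mem_erase.2 ⟨hl, Finset.mem_univ l⟩), zero_mul]
    exact Matrix.diagonal_apply_ne _ hne.symm
  · intro b
    congr 1
    refine Finset.prod_congr rfl fun l hl => ?_
    rw [Function.update_of_ne (Finset.ne_of_mem_erase hl), Matrix.diagonal_apply_eq]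

/-- Exchanging the `k`-th index with a distinct value permutes the pairs of a multi-index and a
value different from its `k`-th entry. -/
theorem sum_sum_erase_update (k : Fin K) (G : (∀ k, Fin (p k)) → Fin (p k) → ℝ) :
    ∑ i : (∀ k, Fin (p k)), ∑ b ∈ Finset.univ.erase (i k), G i b =
      ∑ i : (∀ k, Fin (p k)), ∑ b ∈ Finset.univ.erase (i k), G (Function.update i k b) (i k) := by
  rw [Finset.sum_sigma', Finset.sum_sigma']
  refine Finset.sum_nbij' (fun x => ⟨Function.update x.1 k x.2, x.1 k⟩)
    (fun x => ⟨Function.update x.1 k x.2, x.1 k⟩) ?_ ?_ ?_ ?_ ?_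
  · rintro ⟨i, b⟩ h
    simpa [eq_comm] using h
  · rintro ⟨i, b⟩ h
    simpa [eq_comm] using h
  · rintro ⟨i, b⟩ h
    simp
  · rintro ⟨i, b⟩ h
    simp
  · rintro ⟨i, b⟩ h
    simp

/-! ### Derivative of the Gram matrices of the unfoldings -/

/-- The Gram matrix `Y_(k) Y_(k)ᵀ` of the mode-`k` unfolding. -/
def gram (k : Fin K) (Y : Tensor p) : Matrix (Fin (p k)) (Fin (p k)) ℝ :=
  Y.unfolding k * (Y.unfolding k)ᵀ

/-- The derivative at `S` of the entry `(a, b)` of the mode-`k` Gram matrix. -/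
noncomputable def gramDeriv (S : Tensor p) (k : Fin K) (a b : Fin (p k)) : Tensor p →L[ℝ] ℝ :=
  ∑ c, (S ((Equiv.piSplitAt k fun l => Fin (p l)).symm (a, c)) •
      ContinuousLinearMap.proj ((Equiv.piSplitAt k fun l => Fin (p l)).symm (b, c)) +
    S ((Equiv.piSplitAt k fun l => Fin (p l)).symm (b, c)) •
      ContinuousLinearMap.proj ((Equiv.piSplitAt k fun l => Fin (p l)).symm (a, c)))

theorem hasFDerivAt_gram (S : Tensor p) (k : Fin K) (a b : Fin (p k)) :
    HasFDerivAt (fun Y => gram k Y a b) (gramDeriv S k a b) S := by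
  simp only [gram, Matrix.mul_apply, Matrix.transpose_apply, unfolding, Matrix.of_apply]
  exact HasFDerivAt.fun_sum fun c _ => (hasFDerivAt_apply _ S).mul (hasFDerivAt_apply _ S)

/-- The partial derivative of row `i k` of the Gram matrix along the coordinate `i`. It only sees
the entries of `S` on the mode-`k` fiber through `i`. -/
theorem gramDeriv_single (S : Tensor p) (k : Fin K) (i : ∀ k, Fin (p k)) (b : Fin (p k)) :
    gramDeriv S k (i k) b (Pi.single i 1) =
      S (Function.update i k b) + if b = i k then S i else 0 := by
  obtain ⟨⟨a, c₀⟩, rfl⟩ := (Equiv.piSplitAt k fun l => Fin (p l)).symm.surjective i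
  have hk : (Equiv.piSplitAt k fun l => Fin (p l)).symm (a, c₀) k = a := by
    simp [Equiv.piSplitAt]
  rw [hk, piSplitAt_symm_update, add_comm]
  simp only [gramDeriv, sum_apply, add_apply,
    smul_apply, ContinuousLinearMap.proj_apply, Finset.sum_add_distrib,
    Pi.single_apply, EmbeddingLike.apply_eq_iff_eq, Prod.mk.injEq, smul_eq_mul]
  by_cases hb : b = a
  · simp [hb]
  · simp [hb]

/-! ### The estimator at an array whose modes are already diagonalized -/

/-- The eigenvalue form of the shrinkage of singular values: `σ ↦ f(σ) / σ` as a function of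
`σ²`. -/
noncomputable def shrink (f : ∀ k, Fin (p k) → ℝ → ℝ) (k : Fin K) (i : Fin (p k)) (x : ℝ) : ℝ :=
  f k i √x / √x

theorem shrink_sq (f : ∀ k, Fin (p k) → ℝ → ℝ) (k : Fin K) (i : Fin (p k)) {s : ℝ} (hs : 0 ≤ s) :
    shrink f k i (s ^ 2) = f k i s / s := by
  rw [shrink, Real.sqrt_sq hs]

theorem hasDerivAt_shrink (f : ∀ k, Fin (p k) → ℝ → ℝ) (k : Fin K) (i : Fin (p k)) {s : ℝ}
    (hs : 0 < s) (hf : DifferentiableAt ℝ (f k i) s) :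
    HasDerivAt (shrink f k i) ((deriv (f k i) s / s ^ 2 - f k i s / s ^ 3) / 2) (s ^ 2) := by
  have h1 : HasDerivAt (fun x => √x) (1 / (2 * √(s ^ 2))) (s ^ 2) :=
    Real.hasDerivAt_sqrt (by positivity)
  have h2 : HasDerivAt (f k i) (deriv (f k i) s) √(s ^ 2) := by
    rw [Real.sqrt_sq hs.le]
    exact hf.hasDerivAt
  have h3 := (h2.comp (s ^ 2) h1).div h1 (by rw [Real.sqrt_sq hs.le]; exact hs.ne')
  refine h3.congr_deriv ?_
  simp only [Function.comp, Real.sqrt_sq hs.le]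
  field_simp

/-- The matrix `U_k f^k(D_k) D_k⁻¹ U_kᵀ` by which the estimator acts in mode `k`. -/
noncomputable def modeOperator (f : ∀ k, Fin (p k) → ℝ → ℝ) (U : Tensor p → ModeMatrices p)
    (σ : Tensor p → ∀ k, Fin (p k) → ℝ) (Y : Tensor p) : ModeMatrices p := fun k =>
  U Y k * Matrix.diagonal (fun i => shrink f k i (σ Y k i ^ 2)) * (U Y k)ᵀ

theorem diagDInv_eq {s : ∀ k, Fin (p k) → ℝ} (hs : ∀ k i, 0 < s k i) :
    diagDInv s = fun k => Matrix.diagonal fun i => (s k i)⁻¹ := by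
  funext k
  refine Matrix.inv_eq_left_inv ?_
  rw [diagD, Matrix.diagonal_mul_diagonal, ← Matrix.diagonal_one]
  congr 1
  funext i
  exact inv_mul_cancel₀ (hs k i).ne'

/-- Where all singular values are positive, `t(Y)` is the multilinear product of `Y` with functions
of the Gram matrices of `Y`, so the ambiguity of signs of singular vectors cancels. -/
theorem spectralEstimator_eq_tucker_modeOperator (f : ∀ k, Fin (p k) → ℝ → ℝ)
    (U : Tensor p → ModeMatrices p) (σ : Tensor p → ∀ k, Fin (p k) → ℝ) (Y : Tensor p)
    (hpos : ∀ k i, 0 < σ Y k i) :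
    spectralEstimator f U σ Y = tucker (modeOperator f U σ Y) Y := by
  rw [spectralEstimator, core, tucker_tucker, tucker_tucker, tucker_tucker, diagDInv_eq hpos]
  congr 1
  funext k
  dsimp only [modeOperator, diagF]
  rw [Matrix.mul_assoc (U Y k), Matrix.diagonal_mul_diagonal]
  simp only [shrink_sq f k _ (hpos k _).le, div_eq_mul_inv]

section Diagonalized

variable {f : ∀ k, Fin (p k) → ℝ → ℝ} {U : Tensor p → ModeMatrices p}
  {σ : Tensor p → ∀ k, Fin (p k) → ℝ} {S : Tensor p}

theorem gram_eq_diagonal (hHOSVD : ∀ Y, IsHOSVD Y (U Y) (σ Y)) (hU : U S = fun _ => 1)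
    (k : Fin K) : gram k S = Matrix.diagonal fun i => σ S k i ^ 2 := by
  have h := (hHOSVD S).gram k
  rw [hU, Matrix.diagonal_mul_diagonal] at h
  simpa [gram, sq] using h

theorem isBigO_gram_sub (S : Tensor p) (k : Fin K) :
    (fun Y => entrySum (gram k Y - gram k S)) =O[𝓝 S] fun Y => Y - S := by
  refine IsBigO.fun_sum fun a _ => IsBigO.fun_sum fun b _ => ?_
  exact (hasFDerivAt_gram S k a b).isBigO_sub.abs_left

theorem isPerturbation_gram (hHOSVD : ∀ Y, IsHOSVD Y (U Y) (σ Y)) (hU : U S = fun _ => 1)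
    (hpos : ∀ k i, 0 < σ S k i) (hdistinct : ∀ k, Function.Injective (σ S k)) (k : Fin K) :
    IsPerturbation (𝓝 S) (fun Y => U Y k) (fun Y => gram k Y - gram k S)
      (fun i => σ S k i ^ 2) (fun Y i => σ Y k i ^ 2) where
  orthogonal Y := orthogonal_mul_transpose ((hHOSVD Y).orthogonal k)
  antitone Y i j hij := pow_le_pow_left₀ ((hHOSVD Y).nonneg k j) ((hHOSVD Y).antitone k hij) 2
  strictAnti i j hij := pow_lt_pow_left₀
    (((hHOSVD S).antitone k).strictAnti_of_injective (hdistinct k) hij) (hpos k j).le two_ne_zero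
  eq Y := by
    have h := (hHOSVD Y).gram k
    rw [Matrix.diagonal_mul_diagonal] at h
    rw [← gram_eq_diagonal hHOSVD hU k, add_sub_cancel, gram, h]
    simp only [sq]
  tendsto := (isBigO_gram_sub S k).trans_tendsto <| by
    have : Tendsto (fun Y : Tensor p => Y - S) (𝓝 S) (𝓝 (S - S)) :=
      (continuous_id.sub continuous_const).tendsto S
    rwa [sub_self] at this

theorem modeOperator_self (hHOSVD : ∀ Y, IsHOSVD Y (U Y) (σ Y)) (hU : U S = fun _ => 1)
    (k : Fin K) :
    modeOperator f U σ S k = Matrix.diagonal fun i => f k i (σ S k i) / σ S k i := by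
  simp [modeOperator, hU, shrink_sq f k _ ((hHOSVD S).nonneg k _)]

/-- The first-order coefficients of the mode-`k` operator with respect to the mode-`k` Gram
matrix. -/
noncomputable def modeCoeff (f : ∀ k, Fin (p k) → ℝ → ℝ) (s : ∀ k, Fin (p k) → ℝ) (k : Fin K) :
    Fin (p k) → Fin (p k) → ℝ :=
  coeff (fun i => s k i ^ 2) (fun i => f k i (s k i) / s k i)
    fun i => (deriv (f k i) (s k i) / s k i ^ 2 - f k i (s k i) / s k i ^ 3) / 2

/-- The derivative of the mode operators exists for any choice of singular vectors, which need not
be continuous in `Y`. -/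
theorem hasFDerivAt_modeOperator (hHOSVD : ∀ Y, IsHOSVD Y (U Y) (σ Y)) (hU : U S = fun _ => 1)
    (hpos : ∀ k i, 0 < σ S k i) (hdistinct : ∀ k, Function.Injective (σ S k))
    (hf : ∀ k i, DifferentiableAt ℝ (f k i) (σ S k i)) (k : Fin K) (a b : Fin (p k)) :
    HasFDerivAt (fun Y => modeOperator f U σ Y k a b)
      (modeCoeff f (σ S) k a b • gramDeriv S k a b) S := by
  have h1 := ((isPerturbation_gram hHOSVD hU hpos hdistinct k).isLittleO_conj
    (fun i => hasDerivAt_shrink f k i (hpos k i) (hf k i)) a b).trans_isBigO (isBigO_gram_sub S k)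
  have h2 := (hasFDerivAt_gram S k a b).isLittleO.const_mul_left (modeCoeff f (σ S) k a b)
  refine HasFDerivAt.of_isLittleO ((h1.add h2).congr_left fun Y => ?_)
  rw [modeOperator_self hHOSVD hU]
  simp only [shrink_sq f k _ (hpos k _).le, smul_apply, smul_eq_mul,
    Matrix.sub_apply, modeOperator, modeCoeff]
  ring

theorem eventually_singularValue_pos (hHOSVD : ∀ Y, IsHOSVD Y (U Y) (σ Y)) (hU : U S = fun _ => 1)
    (hpos : ∀ k i, 0 < σ S k i) (hdistinct : ∀ k, Function.Injective (σ S k)) :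
    ∀ᶠ Y in 𝓝 S, ∀ k i, 0 < σ Y k i := by
  simp only [eventually_all]
  intro k i
  have h := ((isPerturbation_gram hHOSVD hU hpos hdistinct k).tendsto_eigenvalue
    i).eventually_const_lt (pow_pos (hpos k i) 2)
  filter_upwards [h] with Y hY
  exact ((hHOSVD Y).nonneg k i).lt_of_ne' fun h0 => by simp [h0] at hY

theorem hasFDerivAt_spectralEstimator (hHOSVD : ∀ Y, IsHOSVD Y (U Y) (σ Y))
    (hU : U S = fun _ => 1) (hpos : ∀ k i, 0 < σ S k i)
    (hdistinct : ∀ k, Function.Injective (σ S k))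
    (hf : ∀ k i, DifferentiableAt ℝ (f k i) (σ S k i)) :
    HasFDerivAt (spectralEstimator f U σ) (ContinuousLinearMap.pi fun i => ∑ j,
      ((∏ k, modeOperator f U σ S k (i k) (j k)) • ContinuousLinearMap.proj j +
        S j • ∑ k, (∏ l ∈ Finset.univ.erase k, modeOperator f U σ S l (i l) (j l)) •
          (modeCoeff f (σ S) k (i k) (j k) • gramDeriv S k (i k) (j k)))) S := by
  have h : spectralEstimator f U σ =ᶠ[𝓝 S] fun Y => tucker (modeOperator f U σ Y) Y := by
    filter_upwards [eventually_singularValue_pos hHOSVD hU hpos hdistinct] with Y hY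
    exact spectralEstimator_eq_tucker_modeOperator f U σ Y hY
  refine HasFDerivAt.congr_of_eventuallyEq ?_ h
  refine hasFDerivAt_pi.2 fun i => HasFDerivAt.fun_sum fun j _ => ?_
  exact (HasFDerivAt.finsetProd fun k _ =>
    hasFDerivAt_modeOperator hHOSVD hU hpos hdistinct hf k (i k) (j k)).mul (hasFDerivAt_apply j S)

end Diagonalized

end Tensor

namespace Tensor

variable {K : ℕ} {p : Fin K → ℕ}

open DiagonalPerturbation

/-! ### The divergence formula for diagonal Gram matrices -/

section Divergence

variable {f : ∀ k, Fin (p k) → ℝ → ℝ} {U : Tensor p → ModeMatrices p}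
  {σ : Tensor p → ∀ k, Fin (p k) → ℝ} {S : Tensor p}

/-- The contribution of mode `k` to `∂t_i/∂x_i`: the term `b = i k` carries the derivative of
`f_{i k}`, the others the divided differences of `f_b / σ_b` in `σ_b²`. -/
theorem sum_modeCoeff_mul_gramDeriv (f : ∀ k, Fin (p k) → ℝ → ℝ) (s : ∀ k, Fin (p k) → ℝ)
    (S : Tensor p) (k : Fin K) (i : ∀ k, Fin (p k)) :
    ∑ b, S (Function.update i k b) *
        (modeCoeff f s k (i k) b * gramDeriv S k (i k) b (Pi.single i 1)) =
      (deriv (f k (i k)) (s k (i k)) / s k (i k) ^ 2 -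
          f k (i k) (s k (i k)) / s k (i k) ^ 3) * S i ^ 2 +
        ∑ b ∈ Finset.univ.erase (i k), (f k (i k) (s k (i k)) / s k (i k) - f k b (s k b) / s k b) /
          (s k (i k) ^ 2 - s k b ^ 2) * S (Function.update i k b) ^ 2 := by
  rw [← Finset.add_sum_erase _ _ (Finset.mem_univ (i k))]
  congr 1
  · rw [gramDeriv_single, Function.update_eq_self, if_pos rfl, modeCoeff, coeff, if_pos rfl]
    ring
  · refine Finset.sum_congr rfl fun b hb => ?_
    have hne := Finset.ne_of_mem_erase hb
    rw [gramDeriv_single, if_neg hne, modeCoeff, coeff, if_neg hne.symm]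
    ring

/-- The divergence at an array with diagonal Gram matrices, before the terms are regrouped. -/
theorem divergence_spectralEstimator (hHOSVD : ∀ Y, IsHOSVD Y (U Y) (σ Y))
    (hU : U S = fun _ => 1) (hpos : ∀ k i, 0 < σ S k i)
    (hdistinct : ∀ k, Function.Injective (σ S k))
    (hf : ∀ k i, DifferentiableAt ℝ (f k i) (σ S k i)) :
    divergence (spectralEstimator f U σ) S =
      ∑ i, ((∏ k, f k (i k) (σ S k (i k)) / σ S k (i k)) +
        ∑ k, (∏ l ∈ Finset.univ.erase k, f l (i l) (σ S l (i l)) / σ S l (i l)) *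
          ((deriv (f k (i k)) (σ S k (i k)) / σ S k (i k) ^ 2 -
              f k (i k) (σ S k (i k)) / σ S k (i k) ^ 3) * S i ^ 2 +
            ∑ b ∈ Finset.univ.erase (i k),
              (f k (i k) (σ S k (i k)) / σ S k (i k) - f k b (σ S k b) / σ S k b) /
                (σ S k (i k) ^ 2 - σ S k b ^ 2) * S (Function.update i k b) ^ 2)) := by
  rw [divergence, (hasFDerivAt_spectralEstimator hHOSVD hU hpos hdistinct hf).fderiv]
  refine Finset.sum_congr rfl fun i _ => ?_
  simp only [ContinuousLinearMap.pi_apply, sum_apply, add_apply, smul_apply,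
    ContinuousLinearMap.proj_apply, smul_eq_mul, modeOperator_self hHOSVD hU,
    Finset.sum_add_distrib]
  congr 1
  · have := tucker_diagonal (fun k a => f k a (σ S k a) / σ S k a) (Pi.single i (1 : ℝ)) i
    rw [tucker] at this
    rw [this, Pi.single_eq_same, mul_one]
  · simp only [Finset.mul_sum]
    rw [Finset.sum_comm]
    refine Finset.sum_congr rfl fun k _ => ?_
    have h := sum_prod_erase_diagonal (fun l a => f l a (σ S l a) / σ S l a) k i fun j =>
      S j * (modeCoeff f (σ S) k (i k) (j k) * gramDeriv S k (i k) (j k) (Pi.single i 1))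
    simp only [Function.update_self] at h
    rw [← sum_modeCoeff_mul_gramDeriv, ← h]
    exact Finset.sum_congr rfl fun j _ => by ring

/-- Exchanging the indices `i k` and `b` collects the terms of the divided differences that
involve `f_b` as multiples of `S_i²`. -/
theorem sum_prod_erase_swap (h s : ∀ k, Fin (p k) → ℝ) (S : Tensor p) (k : Fin K) :
    ∑ i : (∀ k, Fin (p k)), (∏ l ∈ Finset.univ.erase k, h l (i l)) *
        ∑ b ∈ Finset.univ.erase (i k),
          h k b / (s k (i k) ^ 2 - s k b ^ 2) * S (Function.update i k b) ^ 2 =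
      ∑ i : (∀ k, Fin (p k)), (∏ l, h l (i l)) *
        (S i ^ 2 * ∑ m ∈ Finset.univ.erase (i k), 1 / (s k m ^ 2 - s k (i k) ^ 2)) := by
  simp only [Finset.mul_sum]
  rw [sum_sum_erase_update]
  refine Finset.sum_congr rfl fun i _ => Finset.sum_congr rfl fun b _ => ?_
  rw [← Finset.mul_prod_erase _ _ (Finset.mem_univ k), Function.update_idem,
    Function.update_eq_self, Function.update_self]
  have : ∏ l ∈ Finset.univ.erase k, h l (Function.update i k b l) =
      ∏ l ∈ Finset.univ.erase k, h l (i l) :=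
    Finset.prod_congr rfl fun l hl => by rw [Function.update_of_ne (Finset.ne_of_mem_erase hl)]
  rw [this]
  ring

theorem tucker_listH (f : ∀ k, Fin (p k) → ℝ → ℝ) {s : ∀ k, Fin (p k) → ℝ}
    (hs : ∀ k i, 0 < s k i) (k : Fin K) (X : Tensor p) (i : ∀ k, Fin (p k)) :
    tucker (listH f s k) X i =
      (∏ l ∈ Finset.univ.erase k, f l (i l) (s l (i l)) / s l (i l)) *
        (deriv (f k (i k)) (s k (i k)) / s k (i k) ^ 2) * X i := by
  have h : listH f s k = fun l => Matrix.diagonal fun a =>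
      if l = k then deriv (f l a) (s l a) / s l a ^ 2 else f l a (s l a) / s l a := by
    funext l
    simp only [listH, diagF, diagDInv_eq hs, Matrix.diagonal_mul_diagonal]
    split_ifs
    · congr 1
      funext a
      rw [div_eq_mul_inv, sq, mul_inv]
    · simp only [div_eq_mul_inv]
  rw [h, tucker_diagonal, ← Finset.mul_prod_erase _ _ (Finset.mem_univ k), if_pos rfl,
    mul_comm (deriv _ _ / _)]
  congr 2
  exact Finset.prod_congr rfl fun l hl => if_neg (Finset.ne_of_mem_erase hl)

theorem divergenceFormula_eq (f : ∀ k, Fin (p k) → ℝ → ℝ) {s : ∀ k, Fin (p k) → ℝ}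
    (hs : ∀ k i, 0 < s k i) (S : Tensor p) :
    divergenceFormula f S s = ∑ i, ((∏ k, f k (i k) (s k (i k)) / s k (i k)) * arrayC S s i +
      ∑ k, (∏ l ∈ Finset.univ.erase k, f l (i l) (s l (i l)) / s l (i l)) *
        (deriv (f k (i k)) (s k (i k)) / s k (i k) ^ 2) * S i ^ 2) := by
  refine Finset.sum_congr rfl fun i _ => ?_
  rw [Pi.add_apply, Finset.sum_apply]
  simp only [tucker_listH f hs, Pi.pow_apply]
  congr 1
  unfold diagF
  rw [diagDInv_eq hs, tucker_diagonal, tucker_diagonal, ← mul_assoc,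
    ← Finset.prod_mul_distrib]
  simp only [div_eq_mul_inv]

theorem divergence_eq_divergenceFormula (hHOSVD : ∀ Y, IsHOSVD Y (U Y) (σ Y))
    (hU : U S = fun _ => 1) (hpos : ∀ k i, 0 < σ S k i)
    (hdistinct : ∀ k, Function.Injective (σ S k))
    (hf : ∀ k i, DifferentiableAt ℝ (f k i) (σ S k i)) :
    divergence (spectralEstimator f U σ) S = divergenceFormula f S (σ S) := by
  rw [divergence_spectralEstimator hHOSVD hU hpos hdistinct hf, divergenceFormula_eq f hpos]
  generalize σ S = s at hpos hdistinct hf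
  have hswap := Finset.sum_congr (rfl : (Finset.univ : Finset (Fin K)) = Finset.univ)
    fun k _ => sum_prod_erase_swap (fun k a => f k a (s k a) / s k a) s S k
  rw [Finset.sum_comm, Finset.sum_comm (f := fun (k : Fin K) (i : ∀ k, Fin (p k)) =>
    (∏ l, f l (i l) (s l (i l)) / s l (i l)) * (S i ^ 2 * _))] at hswap
  -- the two sides agree, index by index, up to the vanishing difference in `hswap`
  rw [← sub_eq_zero] at hswap ⊢
  rw [← neg_eq_zero, ← hswap, ← Finset.sum_sub_distrib, ← Finset.sum_sub_distrib,
    ← Finset.sum_neg_distrib]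
  refine Finset.sum_congr rfl fun i _ => ?_
  rw [arrayC]
  have hk : ∀ k, (∏ l, f l (i l) (s l (i l)) / s l (i l)) =
      (∏ l ∈ Finset.univ.erase k, f l (i l) (s l (i l)) / s l (i l)) *
        (f k (i k) (s k (i k)) / s k (i k)) := fun k =>
    (Finset.prod_erase_mul _ _ (Finset.mem_univ k)).symm
  have key : ∀ k,
      (∏ l ∈ Finset.univ.erase k, f l (i l) (s l (i l)) / s l (i l)) *
          ((deriv (f k (i k)) (s k (i k)) / s k (i k) ^ 2 -
              f k (i k) (s k (i k)) / s k (i k) ^ 3) * S i ^ 2 +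
            ∑ b ∈ Finset.univ.erase (i k),
              (f k (i k) (s k (i k)) / s k (i k) - f k b (s k b) / s k b) /
                (s k (i k) ^ 2 - s k b ^ 2) * S (Function.update i k b) ^ 2) =
        (∏ l, f l (i l) (s l (i l)) / s l (i l)) *
          (∑ j ∈ Finset.univ.erase (i k),
            S (Function.update i k j) ^ 2 / (s k (i k) ^ 2 - s k j ^ 2)) -
        (∏ l, f l (i l) (s l (i l)) / s l (i l)) * (S i ^ 2 * (1 / s k (i k) ^ 2)) +
        (∏ l ∈ Finset.univ.erase k, f l (i l) (s l (i l)) / s l (i l)) *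
          (deriv (f k (i k)) (s k (i k)) / s k (i k) ^ 2) * S i ^ 2 -
        (∏ l ∈ Finset.univ.erase k, f l (i l) (s l (i l)) / s l (i l)) *
          ∑ b ∈ Finset.univ.erase (i k), f k b (s k b) / s k b /
            (s k (i k) ^ 2 - s k b ^ 2) * S (Function.update i k b) ^ 2 := by
    intro k
    have hsum : ∑ b ∈ Finset.univ.erase (i k),
          (f k (i k) (s k (i k)) / s k (i k) - f k b (s k b) / s k b) /
            (s k (i k) ^ 2 - s k b ^ 2) * S (Function.update i k b) ^ 2 =
        f k (i k) (s k (i k)) / s k (i k) * (∑ j ∈ Finset.univ.erase (i k),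
            S (Function.update i k j) ^ 2 / (s k (i k) ^ 2 - s k j ^ 2)) -
          ∑ b ∈ Finset.univ.erase (i k), f k b (s k b) / s k b /
            (s k (i k) ^ 2 - s k b ^ 2) * S (Function.update i k b) ^ 2 := by
      rw [Finset.mul_sum, ← Finset.sum_sub_distrib]
      exact Finset.sum_congr rfl fun b _ => by ring
    rw [hsum, hk k]
    ring
  simp only [key, Finset.sum_sub_distrib, Finset.sum_add_distrib, ← Finset.mul_sum]
  ring

end Divergence

/-! ### Equivariance under orthogonal changes of coordinates -/

/-- In coordinates rotated by `Q`, a choice of singular vectors `U` becomes `Qᵀ U`. -/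
def rotate (Q : ModeMatrices p) (U : Tensor p → ModeMatrices p) (Z : Tensor p) : ModeMatrices p :=
  fun k => (Q k)ᵀ * U (tucker Q Z) k

theorem isHOSVD_rotate {Q : ModeMatrices p} {U : Tensor p → ModeMatrices p}
    {σ : Tensor p → ∀ k, Fin (p k) → ℝ}
    (hQ : ∀ k, Q k ∈ Matrix.orthogonalGroup (Fin (p k)) ℝ)
    (hHOSVD : ∀ Y, IsHOSVD Y (U Y) (σ Y)) (Z : Tensor p) :
    IsHOSVD Z (rotate Q U Z) (σ (tucker Q Z)) where
  orthogonal k := by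
    have h := orthogonal_transpose_mul ((hHOSVD (tucker Q Z)).orthogonal k)
    refine (Matrix.mem_orthogonalGroup_iff' _ _).2 ?_
    rw [rotate, Matrix.transpose_mul, Matrix.transpose_transpose, Matrix.mul_assoc,
      ← Matrix.mul_assoc (Q k), orthogonal_mul_transpose (hQ k), Matrix.one_mul, h]
  nonneg := (hHOSVD (tucker Q Z)).nonneg
  antitone := (hHOSVD (tucker Q Z)).antitone
  gram k := by
    have h := (hHOSVD (tucker Q Z)).gram k
    rw [gram_unfolding_tucker hQ] at h
    have h1 := orthogonal_transpose_mul (hQ k)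
    have h2 := congrArg (fun A => (Q k)ᵀ * A * Q k) h
    simp only [Matrix.mul_assoc, h1, Matrix.mul_one] at h2
    rw [← Matrix.mul_assoc (Q k)ᵀ (Q k), h1, Matrix.one_mul] at h2
    rw [h2, rotate, Matrix.transpose_mul, Matrix.transpose_transpose]
    simp only [Matrix.mul_assoc]

theorem spectralEstimator_rotate (f : ∀ k, Fin (p k) → ℝ → ℝ) {Q : ModeMatrices p}
    (hQ : ∀ k, Q k ∈ Matrix.orthogonalGroup (Fin (p k)) ℝ) (U : Tensor p → ModeMatrices p)
    (σ : Tensor p → ∀ k, Fin (p k) → ℝ) (Y : Tensor p) :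
    spectralEstimator f U σ Y = tucker Q (spectralEstimator f (rotate Q U)
      (fun Z => σ (tucker Q Z)) (tucker (fun k => (Q k)ᵀ) Y)) := by
  have h : rotate Q U (tucker (fun k => (Q k)ᵀ) Y) = fun k => (Q k)ᵀ * U Y k := by
    funext k
    rw [rotate, tucker_tucker_transpose hQ]
  simp only [spectralEstimator, core, h, tucker_tucker_transpose hQ, Matrix.transpose_mul,
    Matrix.transpose_transpose]
  rw [← tucker_tucker (fun k => (U Y k)ᵀ) Q, tucker_tucker_transpose hQ,
    ← tucker_tucker (fun k => (Q k)ᵀ) (U Y), tucker_tucker_transpose hQ]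

theorem divergence_eq_trace (t : Tensor p → Tensor p) (X : Tensor p) :
    divergence t X = LinearMap.trace ℝ (Tensor p) (fderiv ℝ t X : Tensor p →ₗ[ℝ] Tensor p) := by
  rw [LinearMap.trace_eq_matrix_trace ℝ (Pi.basisFun ℝ (∀ k, Fin (p k)))]
  simp [divergence, Matrix.trace]

/-- Divergence is invariant under linear changes of coordinates. -/
theorem divergence_conj (e : Tensor p ≃L[ℝ] Tensor p) (t : Tensor p → Tensor p) (X : Tensor p) :
    divergence (fun Y => e (t (e.symm Y))) X = divergence t (e.symm X) := by
  have h : fderiv ℝ (fun Y => e (t (e.symm Y))) X =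
      (e : Tensor p →L[ℝ] Tensor p).comp ((fderiv ℝ t (e.symm X)).comp
        (e.symm : Tensor p →L[ℝ] Tensor p)) := by
    rw [← e.symm.comp_right_fderiv, ← e.comp_fderiv]
    rfl
  rw [divergence_eq_trace, divergence_eq_trace, h,
    ← LinearMap.trace_conj' (fderiv ℝ t (e.symm X) : Tensor p →ₗ[ℝ] Tensor p) e.toLinearEquiv]
  rfl

end Tensor

open Tensor in
theorem mainTheorem3 {K : ℕ} (p : Fin K → ℕ) (f : ∀ k, Fin (p k) → ℝ → ℝ)
    (U : Tensor p → ModeMatrices p) (σ : Tensor p → ∀ k, Fin (p k) → ℝ)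
    (hHOSVD : ∀ Y : Tensor p, Tensor.IsHOSVD Y (U Y) (σ Y))
    (X : Tensor p) (hpos : ∀ k i, 0 < σ X k i) (hdistinct : ∀ k, Function.Injective (σ X k))
    (hf : ∀ k i, DifferentiableAt ℝ (f k i) (σ X k i)) :
    DifferentiableAt ℝ (Tensor.spectralEstimator f U σ) X ∧
      Tensor.divergence (Tensor.spectralEstimator f U σ) X =
        Tensor.divergenceFormula f (Tensor.core (U X) X) (σ X) ∧
      ∀ τ : ℝ, Tensor.sure τ (Tensor.spectralEstimator f U σ) X =
        Tensor.frobSq (Tensor.tucker (Tensor.diagF f (σ X))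
            (Tensor.tucker (Tensor.diagDInv (σ X)) (Tensor.core (U X) X))
          - Tensor.core (U X) X)
        + 2 * τ ^ 2 * Tensor.divergenceFormula f (Tensor.core (U X) X) (σ X)
        - ((∏ k, p k : ℕ) : ℝ) * τ ^ 2 := by
  have hQ := (hHOSVD X).orthogonal
  -- rotating by the singular vectors of `X` moves `X` to its core array, where they are trivial
  have hX : tucker (U X) (core (U X) X) = X := tucker_tucker_transpose hQ X
  have hS : rotate (U X) U (core (U X) X) = fun _ => 1 := by
    funext k
    rw [rotate, hX, orthogonal_transpose_mul (hQ k)]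
  obtain ⟨σ', hσ'⟩ : ∃ σ', σ' = fun Z => σ (tucker (U X) Z) := ⟨_, rfl⟩
  have hσ : σ' (core (U X) X) = σ X := by
    rw [hσ']
    exact congrArg σ hX
  have hH : ∀ Z, IsHOSVD Z (rotate (U X) U Z) (σ' Z) := by
    rw [hσ']
    exact isHOSVD_rotate hQ hHOSVD
  obtain ⟨e, he, he'⟩ : ∃ e : Tensor p ≃L[ℝ] Tensor p,
      (∀ Y, e Y = tucker (U X) Y) ∧ ∀ Y, e.symm Y = tucker (fun k => (U X k)ᵀ) Y :=
    ⟨(tuckerEquiv (U X) hQ).toContinuousLinearEquiv, fun _ => rfl, fun _ => rfl⟩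
  have ht : spectralEstimator f U σ =
      fun Y => e (spectralEstimator f (rotate (U X) U) σ' (e.symm Y)) := by
    funext Y
    rw [spectralEstimator_rotate f hQ U σ Y, he, he', hσ']
  have heX : e.symm X = core (U X) X := he' X
  rw [← hσ] at hpos hdistinct hf
  have hdiff : DifferentiableAt ℝ (spectralEstimator f U σ) X := by
    have h := (hasFDerivAt_spectralEstimator hH hS hpos hdistinct hf).differentiableAt
    rw [← heX] at h
    rw [ht]
    exact e.differentiableAt.comp X (h.comp X e.symm.differentiableAt)
  have hdiv : divergence (spectralEstimator f U σ) X =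
      divergenceFormula f (core (U X) X) (σ X) := by
    rw [ht, divergence_conj, heX, divergence_eq_divergenceFormula hH hS hpos hdistinct hf, hσ]
  refine ⟨hdiff, hdiv, fun τ => ?_⟩
  have hfrob : spectralEstimator f U σ X - X = tucker (U X) (tucker (diagF f (σ X))
      (tucker (diagDInv (σ X)) (core (U X) X)) - core (U X) X) := by
    rw [tucker_sub, hX, spectralEstimator]
  rw [sure, hfrob, frobSq_tucker hQ, hdiv]
  ring
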